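/- Let $k$ be a perfect field, let $A$ and $B$ be $k$-algebras, let $M$ be a $B$-$A$-bimodule and $N$ an $A$-$B$-bimodule (with $k$ acting centrally), and let $\Lambda=\begin{pmatrix} A & N\\ M & B\end{pmatrix}$ be the corresponding null-square algebra: its product is given by matrix multiplication, using the products of $A$ and $B$ and the bimodule structures of $M$ and $N$, and setting $mn=0$ and $nm=0$ for all $m\in M$, $n\in N$. Suppose that $\Lambda$ is finite dimensional over $k$, that $M$ and $N$ are projective bimodules (that is, projective as modules over $B\otimes_k A^{\mathrm{op}}$ and $A\otimes_k B^{\mathrm{op}}$ respectively), and that $A$ and $B$ are of finite global dimension. If $(N\otimes_B M)^{\otimes_A n}=0$ for all large enough $n$, then $\Lambda$ is of finite global dimension. -/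

import Mathlib

open scoped TensorProduct
open MulOpposite CategoryTheory

universe v u

/-- An `A`-`B`-bimodule over `k`: a `k`-vector space with a left action of `A` and a right action
of `B` (encoded, as usual in Mathlib, as an action of `Bᵐᵒᵖ`) which commute with each other and
both induce the given action of `k`. -/
structure Bimodule (k : Type v) [Field k] (A B : Type u) [Ring A] [Ring B]
    [Algebra k A] [Algebra k B] where
  carrier : Type u
  [addCommGroup : AddCommGroup carrier]
  [module : Module k carrier]
  [leftModule : Module A carrier]
  [rightModule : Module Bᵐᵒᵖ carrier]
  [smulCommClass : SMulCommClass A Bᵐᵒᵖ carrier]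
  [leftTower : IsScalarTower k A carrier]
  [rightTower : IsScalarTower k Bᵐᵒᵖ carrier]

namespace Bimodule

variable {k : Type v} [Field k] {A B C : Type u} [Ring A] [Ring B] [Ring C]
  [Algebra k A] [Algebra k B] [Algebra k C]

instance : CoeSort (Bimodule k A B) (Type u) := ⟨Bimodule.carrier⟩

attribute [instance] Bimodule.addCommGroup Bimodule.module Bimodule.leftModule
  Bimodule.rightModule Bimodule.smulCommClass Bimodule.leftTower Bimodule.rightTower

/-- An `A`-`B`-bimodule is projective if it is projective as a left module over `A ⊗ Bᵒᵖ`,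
acting by `(a ⊗ b) x = a x b`. -/
def IsProjective (U : Bimodule k A B) : Prop :=
  letI : Module (A ⊗[k] Bᵐᵒᵖ) U := TensorProduct.Algebra.module
  Module.Projective (A ⊗[k] Bᵐᵒᵖ) U

/-- The relations `u b ⊗ v = u ⊗ b v`. -/
def tensorRel (U : Bimodule k A B) (V : Bimodule k B C) : Submodule k (U ⊗[k] V) :=
  Submodule.span k {t | ∃ (u : U) (b : B) (v : V),
    t = (op b • u) ⊗ₜ[k] v - u ⊗ₜ[k] (b • v)}

/-- The underlying vector space of `U ⊗_B V`. -/
abbrev TensorSpace (U : Bimodule k A B) (V : Bimodule k B C) : Type u :=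
  (U ⊗[k] V) ⧸ tensorRel U V

/-- The map `f ⊗_B g`, for `f` linear over `B` on the right and `g` linear over `B` on the left. -/
def tensorMap (U : Bimodule k A B) (V : Bimodule k B C)
    (f : U →ₗ[Bᵐᵒᵖ] U) (g : V →ₗ[B] V) : TensorSpace U V →ₗ[k] TensorSpace U V :=
  Submodule.mapQ (tensorRel U V) (tensorRel U V)
    (TensorProduct.map (f.restrictScalars k) (g.restrictScalars k)) (by
      unfold tensorRel
      rw [Submodule.span_le]
      rintro _ ⟨u, b, v, rfl⟩
      refine Submodule.subset_span ⟨f u, b, g v, ?_⟩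
      simp)

@[simp] lemma tensorMap_mk (U : Bimodule k A B) (V : Bimodule k B C)
    (f : U →ₗ[Bᵐᵒᵖ] U) (g : V →ₗ[B] V) (u : U) (v : V) :
    tensorMap U V f g (Submodule.Quotient.mk (u ⊗ₜ[k] v)) =
      Submodule.Quotient.mk (f u ⊗ₜ[k] g v) := rfl

lemma tensorSpace_hom_ext {U : Bimodule k A B} {V : Bimodule k B C}
    {f g : TensorSpace U V →ₗ[k] TensorSpace U V}
    (h : ∀ (u : U) (v : V), f (Submodule.Quotient.mk (u ⊗ₜ[k] v)) =
      g (Submodule.Quotient.mk (u ⊗ₜ[k] v))) : f = g := by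
  apply Submodule.linearMap_qext
  apply TensorProduct.ext'
  exact h

/-- The action `a (u ⊗ v) = a u ⊗ v`. -/
def leftAct (U : Bimodule k A B) (V : Bimodule k B C) :
    A →+* Module.End k (TensorSpace U V) where
  toFun a := tensorMap U V (DistribSMul.toLinearMap Bᵐᵒᵖ U a) LinearMap.id
  map_one' := tensorSpace_hom_ext fun u v => by simp
  map_mul' a a' := tensorSpace_hom_ext fun u v => by simp [mul_smul]
  map_zero' := tensorSpace_hom_ext fun u v => by simp
  map_add' a a' := tensorSpace_hom_ext fun u v => by simp [add_smul, TensorProduct.add_tmul]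

/-- The action `(u ⊗ v) c = u ⊗ v c`. -/
def rightAct (U : Bimodule k A B) (V : Bimodule k B C) :
    Cᵐᵒᵖ →+* Module.End k (TensorSpace U V) where
  toFun c :=
    letI : SMulCommClass Cᵐᵒᵖ B V := SMulCommClass.symm _ _ _
    tensorMap U V LinearMap.id (DistribSMul.toLinearMap B V c)
  map_one' := tensorSpace_hom_ext fun u v => by simp
  map_mul' c c' := tensorSpace_hom_ext fun u v => by simp [mul_smul]
  map_zero' := tensorSpace_hom_ext fun u v => by simp
  map_add' c c' := tensorSpace_hom_ext fun u v => by simp [add_smul, TensorProduct.tmul_add]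

/-- The tensor product `U ⊗_B V` of an `A`-`B`-bimodule and a `B`-`C`-bimodule, as an
`A`-`C`-bimodule. -/
def tensor (U : Bimodule k A B) (V : Bimodule k B C) : Bimodule k A C :=
  letI mA : Module A (TensorSpace U V) := Module.compHom _ (leftAct U V)
  letI mC : Module Cᵐᵒᵖ (TensorSpace U V) := Module.compHom _ (rightAct U V)
  { carrier := TensorSpace U V
    leftModule := mA
    rightModule := mC
    smulCommClass := ⟨fun a c x => by
      change (leftAct U V a * rightAct U V c) x = (rightAct U V c * leftAct U V a) x
      congr 1
      exact tensorSpace_hom_ext fun u v => rfl⟩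
    leftTower := ⟨fun r a x => by
      change leftAct U V (r • a) x = (r • leftAct U V a) x
      congr 1
      exact tensorSpace_hom_ext fun u v => by
        simp [leftAct, ← TensorProduct.smul_tmul', ← Submodule.Quotient.mk_smul]⟩
    rightTower := ⟨fun r c x => by
      change rightAct U V (r • c) x = (r • rightAct U V c) x
      congr 1
      exact tensorSpace_hom_ext fun u v => by
        simp [rightAct, ← Submodule.Quotient.mk_smul]⟩ }

variable (k A) in
/-- The regular bimodule `A`. -/
def regular : Bimodule k A A where
  carrier := A

/-- The tensor powers `U ⊗_A ⋯ ⊗_A U`, with the regular bimodule `A` as the zeroth power. -/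
def tensorPow (U : Bimodule k A A) : ℕ → Bimodule k A A
  | 0 => regular k A
  | n + 1 => U.tensor (U.tensorPow n)

end Bimodule

/-- The null-square algebra with diagonal entries in `A` and `B`, and with
off-diagonal entries `n : N` (top right) and `m : M` (bottom left). -/
@[ext]
structure NullSquareAlgebra {k : Type v} [Field k] {A B : Type u} [Ring A] [Ring B]
    [Algebra k A] [Algebra k B] (M : Bimodule k B A) (N : Bimodule k A B) : Type u where
  a : A
  n : N
  m : M
  b : B

namespace NullSquareAlgebra

variable {k : Type v} [Field k] {A B : Type u} [Ring A] [Ring B]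
  [Algebra k A] [Algebra k B] {M : Bimodule k B A} {N : Bimodule k A B}

instance : Zero (NullSquareAlgebra M N) := ⟨⟨0, 0, 0, 0⟩⟩
instance : One (NullSquareAlgebra M N) := ⟨⟨1, 0, 0, 1⟩⟩
instance : Add (NullSquareAlgebra M N) :=
  ⟨fun x y => ⟨x.a + y.a, x.n + y.n, x.m + y.m, x.b + y.b⟩⟩
instance : Neg (NullSquareAlgebra M N) := ⟨fun x => ⟨-x.a, -x.n, -x.m, -x.b⟩⟩

/-- Matrix multiplication, where the products of elements of `N` and `M` are set to zero. -/
instance : Mul (NullSquareAlgebra M N) :=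
  ⟨fun x y => ⟨x.a * y.a, x.a • y.n + op y.b • x.n, op y.a • x.m + x.b • y.m, x.b * y.b⟩⟩

instance : SMul k (NullSquareAlgebra M N) := ⟨fun r x => ⟨r • x.a, r • x.n, r • x.m, r • x.b⟩⟩

@[simp] lemma zero_a : (0 : NullSquareAlgebra M N).a = 0 := rfl
@[simp] lemma zero_n : (0 : NullSquareAlgebra M N).n = 0 := rfl
@[simp] lemma zero_m : (0 : NullSquareAlgebra M N).m = 0 := rfl
@[simp] lemma zero_b : (0 : NullSquareAlgebra M N).b = 0 := rfl
@[simp] lemma one_a : (1 : NullSquareAlgebra M N).a = 1 := rfl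
@[simp] lemma one_n : (1 : NullSquareAlgebra M N).n = 0 := rfl
@[simp] lemma one_m : (1 : NullSquareAlgebra M N).m = 0 := rfl
@[simp] lemma one_b : (1 : NullSquareAlgebra M N).b = 1 := rfl
@[simp] lemma add_a (x y : NullSquareAlgebra M N) : (x + y).a = x.a + y.a := rfl
@[simp] lemma add_n (x y : NullSquareAlgebra M N) : (x + y).n = x.n + y.n := rfl
@[simp] lemma add_m (x y : NullSquareAlgebra M N) : (x + y).m = x.m + y.m := rfl
@[simp] lemma add_b (x y : NullSquareAlgebra M N) : (x + y).b = x.b + y.b := rfl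
@[simp] lemma neg_a (x : NullSquareAlgebra M N) : (-x).a = -x.a := rfl
@[simp] lemma neg_n (x : NullSquareAlgebra M N) : (-x).n = -x.n := rfl
@[simp] lemma neg_m (x : NullSquareAlgebra M N) : (-x).m = -x.m := rfl
@[simp] lemma neg_b (x : NullSquareAlgebra M N) : (-x).b = -x.b := rfl
@[simp] lemma mul_a (x y : NullSquareAlgebra M N) : (x * y).a = x.a * y.a := rfl
@[simp] lemma mul_n (x y : NullSquareAlgebra M N) :
    (x * y).n = x.a • y.n + op y.b • x.n := rfl
@[simp] lemma mul_m (x y : NullSquareAlgebra M N) :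
    (x * y).m = op y.a • x.m + x.b • y.m := rfl
@[simp] lemma mul_b (x y : NullSquareAlgebra M N) : (x * y).b = x.b * y.b := rfl
@[simp] lemma smul_a (r : k) (x : NullSquareAlgebra M N) : (r • x).a = r • x.a := rfl
@[simp] lemma smul_n (r : k) (x : NullSquareAlgebra M N) : (r • x).n = r • x.n := rfl
@[simp] lemma smul_m (r : k) (x : NullSquareAlgebra M N) : (r • x).m = r • x.m := rfl
@[simp] lemma smul_b (r : k) (x : NullSquareAlgebra M N) : (r • x).b = r • x.b := rfl

instance : AddCommGroup (NullSquareAlgebra M N) where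
  add_assoc _ _ _ := by ext <;> simp [add_assoc]
  zero_add _ := by ext <;> simp
  add_zero _ := by ext <;> simp
  add_comm _ _ := by ext <;> simp [add_comm]
  neg_add_cancel _ := by ext <;> simp
  nsmul := nsmulRec
  zsmul := zsmulRec

instance : Ring (NullSquareAlgebra M N) where
  mul_assoc x y z := by
    ext
    · simp [mul_assoc]
    · simp [mul_smul, smul_add, smul_comm x.a (op z.b) y.n, add_assoc]
    · simp [mul_smul, smul_add, smul_comm x.b (op z.a) y.m, add_assoc]
    · simp [mul_assoc]
  one_mul _ := by ext <;> simp
  mul_one _ := by ext <;> simp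
  zero_mul _ := by ext <;> simp
  mul_zero _ := by ext <;> simp
  left_distrib _ _ _ := by
    ext <;> simp [mul_add, add_smul, smul_add] <;> abel
  right_distrib _ _ _ := by
    ext <;> simp [add_mul, add_smul, smul_add] <;> abel
  neg_add_cancel := neg_add_cancel
  zsmul := zsmulRec

instance : Module k (NullSquareAlgebra M N) where
  one_smul _ := by ext <;> simp
  mul_smul _ _ _ := by ext <;> simp [mul_smul]
  smul_zero _ := by ext <;> simp
  smul_add _ _ _ := by ext <;> simp
  add_smul _ _ _ := by ext <;> simp [add_smul]
  zero_smul _ := by ext <;> simp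

instance : Algebra k (NullSquareAlgebra M N) :=
  Algebra.ofModule
    (fun r x y => by ext <;> simp [smul_comm r])
    (fun r x y => by ext <;> simp [smul_comm r])

end NullSquareAlgebra

/-- The (left) global dimension of a ring, that is, the supremum of the projective dimensions of
its left modules. -/
noncomputable def globalDimension (R : Type u) [Ring R] : WithBot ℕ∞ :=
  ⨆ X : ModuleCat.{u} R, projectiveDimension X

lemma globalDimension_lt_top_iff (R : Type u) [Ring R] :
    globalDimension R < ⊤ ↔ ∃ d : ℕ, ∀ X : ModuleCat.{u} R, HasProjectiveDimensionLE X d := by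
  simp only [← projectiveDimension_le_iff]
  unfold globalDimension
  constructor
  · intro h
    obtain ⟨d, hd⟩ : ∃ d : ℕ, (⨆ X : ModuleCat.{u} R, projectiveDimension X) ≤ d := by
      generalize (⨆ X : ModuleCat.{u} R, projectiveDimension X) = g at h
      induction g with
      | bot => exact ⟨0, bot_le⟩
      | coe g =>
        induction g with
        | top => exact absurd h (lt_irrefl _)
        | coe d => exact ⟨d, le_rfl⟩
    exact ⟨d, fun X => (le_iSup (fun X : ModuleCat.{u} R => projectiveDimension X) X).trans hd⟩
  · rintro ⟨d, hd⟩
    refine (iSup_le hd).trans_lt ?_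
    exact WithBot.coe_lt_coe.2 (ENat.natCast_lt_top d)

/-- A smooth algebra is a finite dimensional algebra of finite global dimension. -/
def IsSmoothAlgebra (k : Type v) [Field k] (A : Type u) [Ring A] [Algebra k A] : Prop :=
  FiniteDimensional k A ∧ globalDimension A < ⊤

/-! Let `I` and `J` be the kernels of the projections of `Λ` onto `A` and `B`. Since `I J I = 0`,
the filtration `X ⊇ I X ⊇ J I X` of a `Λ`-module `X` has its subquotients inflated from `A`, `B` and
`A`, so it suffices to bound the projective dimensions of inflated modules
(`hasProjectiveDimensionLT_of_ideals`). As `A` and `B` have finite global dimension, dimension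
shifting reduces this to inflations of projective modules
(`hasProjectiveDimensionLT_restrictScalars`).

Let `e` be the idempotent of `A`. For a projective `A`-module `Y`, the induced module `Λe ⊗_A Y = Y
× (M ⊗_A Y)` is projective over `Λ`, and it maps onto `Y` with kernel `M ⊗_A Y` inflated from `B`.
That kernel is again projective over `B`, because `M` is projective on the left. The same step with
the other column leads to `N ⊗_B M ⊗_A Y`, and so on; each step costs one dimension. After `2n`
steps the syzygy is `(N ⊗_B M)^{⊗n} ⊗_A Y = 0`.

The iterated syzygy is never identified with this tensor product. It suffices that it is generated
by images of `(N ⊗_B M)^{⊗n}` (`Generates.tensor_tensor`), hence vanishes with it. -/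

namespace Bimodule

/-! ### Elements of, and maps out of, the balanced tensor product. -/

variable {k : Type v} [Field k] {A B C : Type u} [Ring A] [Ring B] [Ring C]
  [Algebra k A] [Algebra k B] [Algebra k C]

/-- The pure tensor `u ⊗ v` in `U ⊗_B V`. -/
def tmul (U : Bimodule k A B) (V : Bimodule k B C) (x : U) (y : V) : U.tensor V :=
  (Submodule.Quotient.mk (x ⊗ₜ[k] y) : TensorSpace U V)

section tmul

variable {U : Bimodule k A B} {V : Bimodule k B C}

lemma add_tmul (x x' : U) (y : V) : tmul U V (x + x') y = tmul U V x y + tmul U V x' y :=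
  congrArg Submodule.Quotient.mk (TensorProduct.add_tmul x x' y)

lemma tmul_add (x : U) (y y' : V) : tmul U V x (y + y') = tmul U V x y + tmul U V x y' :=
  congrArg Submodule.Quotient.mk (TensorProduct.tmul_add x y y')

lemma zero_tmul (y : V) : tmul U V 0 y = 0 :=
  congrArg Submodule.Quotient.mk (TensorProduct.zero_tmul _ y)

lemma tmul_zero (x : U) : tmul U V x 0 = 0 :=
  congrArg Submodule.Quotient.mk (TensorProduct.tmul_zero _ x)

lemma smul_tmul (a : A) (x : U) (y : V) : a • tmul U V x y = tmul U V (a • x) y := rfl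

lemma op_smul_tmul (b : B) (x : U) (y : V) : tmul U V (op b • x) y = tmul U V x (b • y) :=
  (Submodule.Quotient.eq _).2 (Submodule.subset_span ⟨x, b, y, rfl⟩)

@[elab_as_elim]
lemma tensor_induction {p : U.tensor V → Prop} (t : U.tensor V) (zero : p 0)
    (tmul : ∀ x y, p (tmul U V x y)) (add : ∀ s t, p s → p t → p (s + t)) : p t := by
  obtain ⟨t, rfl⟩ := Submodule.Quotient.mk_surjective (tensorRel U V) t
  induction t with
  | zero => exact zero
  | tmul x y => exact tmul x y
  | add s t hs ht => exact add _ _ hs ht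

/-- The additive map out of `U ⊗_B V` induced by a balanced biadditive map. -/
def liftAddHom {Z : Type*} [AddCommGroup Z] (f : U →+ V →+ Z)
    (hf : ∀ (x : U) (b : B) (y : V), f (op b • x) y = f x (b • y)) : U.tensor V →+ Z :=
  have hk : ∀ (r : k) (x : U) (y : V), f (r • x) y = f x (r • y) := fun r x y => by
    have := hf x (algebraMap k B r) y
    rwa [algebraMap_smul, ← MulOpposite.algebraMap_apply, algebraMap_smul] at this
  QuotientAddGroup.lift (tensorRel U V).toAddSubgroup (TensorProduct.liftAddHom f hk) (by
    intro t ht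
    -- The lifted map is only additive while the relations are a `k`-span, so the claim is
    -- strengthened to all scalar multiples of `t`.
    have key : ∀ r : k, TensorProduct.liftAddHom f hk (r • t) = 0 := by
      refine Submodule.span_induction (p := fun t _ => ∀ r : k,
        TensorProduct.liftAddHom f hk (r • t) = 0) ?_ ?_ ?_ ?_ ht
      · rintro _ ⟨x, b, y, rfl⟩ r
        rw [smul_sub, TensorProduct.smul_tmul', TensorProduct.smul_tmul', map_sub,
          TensorProduct.liftAddHom_tmul, TensorProduct.liftAddHom_tmul, smul_comm, hf, sub_self]
      · simp
      · intro x y _ _ hx hy r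
        rw [smul_add, map_add, hx, hy, add_zero]
      · intro s x _ hx r
        rw [smul_smul, hx]
    simpa using key 1)

@[simp] lemma liftAddHom_tmul {Z : Type*} [AddCommGroup Z] (f : U →+ V →+ Z)
    (hf : ∀ (x : U) (b : B) (y : V), f (op b • x) y = f x (b • y)) (x : U) (y : V) :
    liftAddHom f hf (tmul U V x y) = f x y := rfl

/-- The linear map out of `U ⊗_B V` induced by a balanced biadditive map which is linear in the
first variable. -/
def lift {Z : Type*} [AddCommGroup Z] [Module A Z] (f : U →+ V →+ Z)
    (hf : ∀ (x : U) (b : B) (y : V), f (op b • x) y = f x (b • y))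
    (hA : ∀ (a : A) (x : U) (y : V), f (a • x) y = a • f x y) : U.tensor V →ₗ[A] Z where
  __ := liftAddHom f hf
  map_smul' a t := by
    change liftAddHom f hf (a • t) = a • liftAddHom f hf t
    induction t using tensor_induction with
    | zero => simp
    | tmul x y => rw [smul_tmul, liftAddHom_tmul, liftAddHom_tmul, hA]
    | add s t hs ht => rw [smul_add, map_add, hs, ht, map_add, smul_add]

lemma addHom_ext {Z : Type*} [AddCommGroup Z] {f g : U.tensor V →+ Z}
    (h : ∀ x y, f (tmul U V x y) = g (tmul U V x y)) : f = g := by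
  ext t
  induction t using tensor_induction with
  | zero => simp
  | tmul x y => exact h x y
  | add s t hs ht => rw [map_add, hs, ht, map_add]

lemma linearMap_ext {Z : Type*} [AddCommGroup Z] [Module A Z] {f g : U.tensor V →ₗ[A] Z}
    (h : ∀ x y, f (tmul U V x y) = g (tmul U V x y)) : f = g :=
  LinearMap.toAddMonoidHom_injective (addHom_ext h)

/-- The map `x ↦ x ⊗ y`. -/
def tmulLeft (y : V) : U →ₗ[A] U.tensor V where
  toFun x := tmul U V x y
  map_add' x x' := add_tmul x x' y
  map_smul' _ _ := rfl

end tmul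

/-! ### Left projectivity of bimodules and of their tensor products. -/

/-- A projective bimodule is projective as a left module. -/
lemma IsProjective.projective_left {U : Bimodule k A B} (hU : U.IsProjective) :
    Module.Projective A U := by
  let _ : Module (A ⊗[k] Bᵐᵒᵖ) U := TensorProduct.Algebra.module
  obtain ⟨s, hs⟩ := Module.projective_def'.1 hU
  have htmul : ∀ (a : A) (t : A ⊗[k] Bᵐᵒᵖ), a • t = (a ⊗ₜ[k] 1) * t := fun a t => by
    induction t with
    | zero => rw [smul_zero, mul_zero]
    | tmul a' b =>
      rw [TensorProduct.smul_tmul', Algebra.TensorProduct.tmul_mul_tmul, one_mul, smul_eq_mul]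
    | add s t hs ht => rw [smul_add, hs, ht, mul_add]
  have : IsScalarTower A (A ⊗[k] Bᵐᵒᵖ) U := ⟨fun a t x => by
    rw [htmul, mul_smul, TensorProduct.Algebra.smul_def, one_smul]⟩
  -- `A ⊗ Bᵐᵒᵖ` is free over `A` because `Bᵐᵒᵖ` is free over the field `k`.
  exact Module.Projective.of_split (M := U →₀ A ⊗[k] Bᵐᵒᵖ) (s.restrictScalars A)
    ((Finsupp.linearCombination (A ⊗[k] Bᵐᵒᵖ) id).restrictScalars A)
    (LinearMap.ext fun x => LinearMap.congr_fun hs x)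

/-- The right multiplication `a ↦ x a`. -/
def rightMul (U : Bimodule k A B) (x : U) : B →+ U :=
  AddMonoidHom.mk' (fun b => op b • x) fun b b' => by
    rw [MulOpposite.op_add, add_smul]

@[simp] lemma rightMul_apply (U : Bimodule k A B) (x : U) (b : B) :
    U.rightMul x b = op b • x := rfl

/-- If `U` and `V` are projective left modules, then so is `U ⊗_B V`. -/
lemma projective_tensor (U : Bimodule k A B) (V : Bimodule k B C)
    [Module.Projective A U] [Module.Projective B V] : Module.Projective A (U.tensor V) := by
  obtain ⟨s, hs⟩ := Module.projective_def'.1 (inferInstance : Module.Projective B V)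
  -- Tensoring the splitting `s` of `B^(V) → V` with `U` makes `U ⊗_B V` a summand of `U^(V)`;
  -- explicitly, `x ⊗ y` goes to `x · s(y)`.
  let i : U.tensor V →ₗ[A] (V →₀ U) := lift
    (AddMonoidHom.mk' (fun x => (Finsupp.mapRange.addMonoidHom (U.rightMul x)).comp
      s.toAddMonoidHom) fun x x' => by
        ext y z
        simp)
    (fun x b y => by
      ext z
      simp [mul_smul])
    (fun a x y => by
      ext z
      simp [smul_comm])
  let p : (V →₀ U) →ₗ[A] U.tensor V := Finsupp.lsum ℕ fun y => tmulLeft y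
  classical
  have : Module.Projective A (V →₀ U) :=
    Module.Projective.of_equiv' (finsuppLEquivDirectSum A U V).symm
  refine Module.Projective.of_split i p (linearMap_ext fun x y => ?_)
  have key : ∀ t : V →₀ B, p (Finsupp.mapRange.addMonoidHom (U.rightMul x) t) =
      tmul U V x (Finsupp.linearCombination B id t) := by
    intro t
    induction t using Finsupp.induction_linear with
    | zero => simp [tmul_zero]
    | add f g hf hg => rw [map_add, map_add, hf, hg, map_add, tmul_add]
    | single y b =>
      have hp : p (Finsupp.single y (op b • x)) = tmul U V (op b • x) y :=
        Finsupp.sum_single_index (map_zero (tmulLeft y))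
      rw [Finsupp.mapRange.addMonoidHom_apply, Finsupp.mapRange_single, rightMul_apply, hp,
        op_smul_tmul, Finsupp.linearCombination_single, id]
  refine (key (s y)).trans ?_
  rw [← LinearMap.comp_apply, hs]
  rfl

/-! ### Generation, a substitute for associativity of iterated tensor products. -/

/-- A family of left linear maps `U → V` whose ranges jointly generate `V`. -/
def Generates (U : Bimodule k A B) (V : Bimodule k A C) : Prop :=
  ⨆ f : U →ₗ[A] V, LinearMap.range f = ⊤

lemma generates_regular (V : Bimodule k A C) : (regular k A).Generates V := by
  refine eq_top_iff.2 fun y _ => ?_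
  refine Submodule.mem_iSup_of_mem (LinearMap.toSpanSingleton A V y) ⟨(1 : A), ?_⟩
  exact one_smul A y

lemma Generates.subsingleton {U : Bimodule k A B} {V : Bimodule k A C} (h : U.Generates V)
    [Subsingleton U] : Subsingleton V := by
  have hbot : (⊥ : Submodule A V) = ⊤ := by
    rw [← h, eq_comm, iSup_eq_bot]
    rintro f
    rw [LinearMap.range_eq_bot]
    exact LinearMap.ext fun x => by rw [Subsingleton.elim x 0, map_zero, map_zero]
  exact subsingleton_of_forall_eq 0 fun y =>
    (Submodule.mem_bot A).1 (hbot ▸ Submodule.mem_top (x := y))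

section assoc

variable {D : Type u} [Ring D] [Algebra k D]

/-- The biadditive map `(n ⊗ m, y) ↦ n ⊗ (m ⊗ y)`. -/
def assocHom (N : Bimodule k A B) (M : Bimodule k B C) (V : Bimodule k C D) :
    N.tensor M →+ V →+ N.tensor (M.tensor V) :=
  liftAddHom
    (AddMonoidHom.mk' (fun n => AddMonoidHom.mk' (fun m => AddMonoidHom.mk'
      (fun y => tmul N (M.tensor V) n (tmul M V m y))
      fun y y' => by rw [tmul_add, tmul_add])
      fun m m' => AddMonoidHom.ext fun y => by
        change tmul N (M.tensor V) n (tmul M V (m + m') y) =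
          tmul N (M.tensor V) n (tmul M V m y) + tmul N (M.tensor V) n (tmul M V m' y)
        rw [add_tmul, tmul_add])
      fun n n' => AddMonoidHom.ext fun m => AddMonoidHom.ext fun y =>
        add_tmul n n' (tmul M V m y))
    fun n b m => AddMonoidHom.ext fun y => op_smul_tmul b n (tmul M V m y)

lemma assocHom_op_smul (N : Bimodule k A B) (M : Bimodule k B C) (V : Bimodule k C D)
    (t : N.tensor M) (c : C) (y : V) :
    assocHom N M V (op c • t) y = assocHom N M V t (c • y) := by
  induction t using tensor_induction with
  | zero => rw [smul_zero, map_zero]; rfl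
  | tmul n m => exact congrArg (tmul N (M.tensor V) n) (op_smul_tmul c m y)
  | add s t hs ht =>
    rw [smul_add, map_add, AddMonoidHom.add_apply, hs, ht, map_add, AddMonoidHom.add_apply]

lemma assocHom_smul (N : Bimodule k A B) (M : Bimodule k B C) (V : Bimodule k C D)
    (a : A) (t : N.tensor M) (y : V) :
    assocHom N M V (a • t) y = a • assocHom N M V t y := by
  induction t using tensor_induction with
  | zero => rw [smul_zero, map_zero, AddMonoidHom.zero_apply, smul_zero]
  | tmul n m => rfl
  | add s t hs ht =>
    rw [smul_add, map_add, AddMonoidHom.add_apply, hs, ht, map_add, AddMonoidHom.add_apply,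
      smul_add]

end assoc

/-- Each `f : U → V` induces `(n ⊗ m) ⊗ w ↦ n ⊗ (m ⊗ f w)`, and the images of these maps contain
enough tensors. This is the inductive step carrying generation by tensor powers to the next syzygy.
-/
lemma Generates.tensor_tensor {D E : Type u} [Ring D] [Algebra k D] [Ring E] [Algebra k E]
    {U : Bimodule k A D} {V : Bimodule k A E} (h : U.Generates V)
    (N : Bimodule k A B) (M : Bimodule k B A) :
    ((N.tensor M).tensor U).Generates (N.tensor (M.tensor V)) := by
  let g (f : U →ₗ[A] V) : (N.tensor M).tensor U →ₗ[A] N.tensor (M.tensor V) :=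
    lift ((AddMonoidHom.compHom' f.toAddMonoidHom).comp (assocHom N M V))
      (fun t a w => (assocHom_op_smul N M V t a (f w)).trans
        (congrArg (assocHom N M V t) (f.map_smul a w).symm))
      (fun a t w => assocHom_smul N M V a t (f w))
  refine eq_top_iff.2 fun t _ => ?_
  induction t using tensor_induction with
  | zero => exact zero_mem _
  | add s t hs ht => exact add_mem (hs trivial) (ht trivial)
  | tmul n z =>
    induction z using tensor_induction with
    | zero => rw [tmul_zero]; exact zero_mem _
    | add s t hs ht => rw [tmul_add]; exact add_mem (hs trivial) (ht trivial)
    | tmul m y =>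
      have hy : y ∈ ⨆ f : U →ₗ[A] V, LinearMap.range f := by rw [h]; trivial
      refine Submodule.iSup_induction (motive := fun y => tmul N (M.tensor V) n (tmul M V m y) ∈
        ⨆ f : (N.tensor M).tensor U →ₗ[A] N.tensor (M.tensor V), LinearMap.range f) _ hy ?_ ?_ ?_
      · rintro f _ ⟨w, rfl⟩
        exact Submodule.mem_iSup_of_mem (g f) ⟨tmul _ U (tmul N M n m) w, rfl⟩
      · rw [tmul_zero, tmul_zero]; exact zero_mem _
      · intro y z hy hz
        rw [tmul_add, tmul_add]; exact add_mem hy hz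

end Bimodule

/-! ### Projective dimension under filtrations and inflation. -/

section ProjectiveDimension

variable {R : Type u} [Ring R]

lemma ModuleCat.shortExact_of_linearMap {X Y Z : ModuleCat.{u} R} (f : X →ₗ[R] Y) (g : Y →ₗ[R] Z)
    (hf : Function.Injective f) (hfg : Function.Exact f g) (hg : Function.Surjective g) :
    (ModuleCat.shortComplexOfCompEqZero f g hfg.linearMap_comp_eq_zero).ShortExact :=
  ModuleCat.shortComplex_shortExact _ hfg hf hg

lemma hasProjectiveDimensionLT_of_submodule {X : Type u} [AddCommGroup X] [Module R X]
    (S : Submodule R X) {n : ℕ} (h₁ : HasProjectiveDimensionLT (ModuleCat.of R S) n)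
    (h₃ : HasProjectiveDimensionLT (ModuleCat.of R (X ⧸ S)) n) :
    HasProjectiveDimensionLT (ModuleCat.of R X) n :=
  (ModuleCat.shortExact_of_linearMap (X := .of R S) (Y := .of R X) (Z := .of R (X ⧸ S))
    S.subtype S.mkQ S.injective_subtype (LinearMap.exact_subtype_mkQ S)
    S.mkQ_surjective).hasProjectiveDimensionLT_X₂ n h₁ h₃

/-- If every module annihilated by `I` and every module annihilated by `J` has projective
dimension less than `n`, and `I J I = 0`, then every module has projective dimension less
than `n`. -/
lemma hasProjectiveDimensionLT_of_ideals (I J : Ideal R) [I.IsTwoSided] [J.IsTwoSided] {n : ℕ}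
    (hIJI : ∀ r ∈ I, ∀ s ∈ J, ∀ t ∈ I, r * s * t = 0)
    (hI : ∀ (X : Type u) [AddCommGroup X] [Module R X], (∀ r ∈ I, ∀ x : X, r • x = 0) →
      HasProjectiveDimensionLT (ModuleCat.of R X) n)
    (hJ : ∀ (X : Type u) [AddCommGroup X] [Module R X], (∀ r ∈ J, ∀ x : X, r • x = 0) →
      HasProjectiveDimensionLT (ModuleCat.of R X) n)
    (X : Type u) [AddCommGroup X] [Module R X] :
    HasProjectiveDimensionLT (ModuleCat.of R X) n := by
  have quot : ∀ (K : Ideal R) (Y : Type u) [AddCommGroup Y] [Module R Y], ∀ r ∈ K,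
      ∀ x : Y ⧸ (K • ⊤ : Submodule R Y), r • x = 0 := by
    intro K Y _ _ r hr x
    obtain ⟨x, rfl⟩ := Submodule.Quotient.mk_surjective _ x
    rw [← Submodule.Quotient.mk_smul, Submodule.Quotient.mk_eq_zero]
    exact Submodule.smul_mem_smul hr trivial
  refine hasProjectiveDimensionLT_of_submodule (I • ⊤ : Submodule R X) ?_ (hI _ (quot I X))
  refine hasProjectiveDimensionLT_of_submodule
    (J • ⊤ : Submodule R (I • ⊤ : Submodule R X)) (hI _ ?_) (hJ _ (quot J _))
  -- `I` kills `J I X` because `I J I = 0`.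
  rintro r hr ⟨y, hy⟩
  refine Subtype.ext ?_
  change r • y = 0
  induction hy using Submodule.smul_induction_on' with
  | add y _ z _ hy hz => rw [smul_add, hy, hz, add_zero]
  | smul s hs x _ =>
    obtain ⟨x, hx⟩ := x
    refine Subtype.ext ?_
    change r • s • x = 0
    induction hx using Submodule.smul_induction_on' with
    | add y _ z _ hy hz => rw [smul_add, smul_add, hy (trivial), hz trivial, add_zero]
    | smul t ht x _ => rw [smul_smul, smul_smul, hIJI r hr s hs t ht, zero_smul]

variable {A : Type u} [Ring A]

/-- Inflation of modules along a ring homomorphism. -/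
noncomputable abbrev inflate (f : R →+* A) (Y : Type u) [AddCommGroup Y] [Module A Y] : ModuleCat.{u} R :=
  (ModuleCat.restrictScalars f).obj (ModuleCat.of A Y)

/-- A bound for the projective dimensions of the inflations of projective modules yields a bound
for the inflations of all modules of finite projective dimension. -/
lemma hasProjectiveDimensionLT_restrictScalars (f : R →+* A) {n : ℕ}
    (h : ∀ P : ModuleCat.{u} A, Projective P →
      HasProjectiveDimensionLT ((ModuleCat.restrictScalars f).obj P) n) (d : ℕ)
    (Y : ModuleCat.{u} A) (hY : HasProjectiveDimensionLE Y d) :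
    HasProjectiveDimensionLT ((ModuleCat.restrictScalars f).obj Y) (n + d) := by
  induction d generalizing Y with
  | zero => exact h Y (projective_iff_hasProjectiveDimensionLE_zero Y |>.2 hY)
  | succ d ih =>
    have hS := Y.shortExact_projectiveShortComplex
    have hP : Projective Y.projectiveShortComplex.X₂ :=
      ModuleCat.projective_of_categoryTheory_projective _
    have hS' := ModuleCat.shortComplex_shortExact
      (Y.projectiveShortComplex.map (ModuleCat.restrictScalars f))
      ((ShortComplex.ShortExact.moduleCat_exact_iff_function_exact
        Y.projectiveShortComplex).1 hS.exact)
      hS.moduleCat_injective_f hS.moduleCat_surjective_g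
    -- Dimension shifting: the inflated syzygy is handled by induction, and the inflated projective
    -- cover term by `h`.
    refine hS'.hasProjectiveDimensionLT_X₃ (n + d) (ih _ ?_) ?_
    · exact hS.hasProjectiveDimensionLT_X₁ (d + 1) inferInstance hY
    · have : HasProjectiveDimensionLT (Y.projectiveShortComplex.map
          (ModuleCat.restrictScalars f)).X₂ n := h _ hP
      exact hasProjectiveDimensionLT_of_ge _ n _ (by omega)

/-- A module annihilated by the kernel of a surjection is inflated. -/
lemma hasProjectiveDimensionLT_of_ker_smul_eq_zero (f : R →+* A) (hf : Function.Surjective f)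
    {n : ℕ} (h : ∀ Y : ModuleCat.{u} A,
      HasProjectiveDimensionLT ((ModuleCat.restrictScalars f).obj Y) n)
    (X : Type u) [AddCommGroup X] [Module R X] (hX : ∀ r ∈ RingHom.ker f, ∀ x : X, r • x = 0) :
    HasProjectiveDimensionLT (ModuleCat.of R X) n := by
  let _ : SMul A X := ⟨fun a x => Function.surjInv hf a • x⟩
  have key : ∀ (r : R) (x : X), f r • x = r • x := fun r x => by
    rw [← sub_eq_zero]
    change Function.surjInv hf (f r) • x - r • x = 0
    rw [← sub_smul]
    exact hX _ (by rw [RingHom.mem_ker, map_sub, Function.surjInv_eq hf, sub_self]) x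
  let _ : Module A X := Function.Surjective.moduleLeft f hf key
  let e : (ModuleCat.restrictScalars f).obj (ModuleCat.of A X) ≃ₗ[R] X :=
    { AddEquiv.refl X with map_smul' := key }
  have := h (ModuleCat.of A X)
  exact hasProjectiveDimensionLT_of_iso (X := (ModuleCat.restrictScalars f).obj (ModuleCat.of A X))
    (X' := ModuleCat.of R X) e.toModuleIso n

end ProjectiveDimension

/-! ### Column modules, treating both columns of the matrix algebra at once. -/

/-- The data which make a ring `R` act on `Y × (M ⊗_A Y)` for every `A`-module `Y` as on a column
of matrices: ring homomorphisms to `A` and `B`, an `M`-valued derivation, and additive sections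
of the coefficient maps. -/
structure ColumnData {k : Type v} [Field k] {A B : Type u} [Ring A] [Ring B]
    [Algebra k A] [Algebra k B] (M : Bimodule k B A) (R : Type u) [Ring R] where
  toFst : R →+* A
  toSnd : R →+* B
  coeff : R →+ M
  coeff_mul : ∀ r s, coeff (r * s) = op (toFst s) • coeff r + toSnd r • coeff s
  diag : A →+ R
  offDiag : M →+ R
  toFst_diag : ∀ a, toFst (diag a) = a
  coeff_diag : ∀ a, coeff (diag a) = 0
  toFst_offDiag : ∀ m, toFst (offDiag m) = 0
  coeff_offDiag : ∀ m, coeff (offDiag m) = m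
  mul_diag : ∀ r a, r * diag a = diag (toFst r * a) + offDiag (op a • coeff r)
  mul_offDiag : ∀ r m, r * offDiag m = offDiag (toSnd r • m)

namespace ColumnData

variable {k : Type v} [Field k] {A B D : Type u} [Ring A] [Ring B] [Ring D]
  [Algebra k A] [Algebra k B] [Algebra k D] {M : Bimodule k B A} {R : Type u} [Ring R]

lemma coeff_one (c : ColumnData M R) : c.coeff 1 = 0 := by
  simpa using c.coeff_mul 1 1

/-- The module `Y × (M ⊗_A Y)` over `R`, that is, the module induced from the `A`-module `Y`. -/
def Column (_ : ColumnData M R) (Y : Bimodule k A D) : Type u := Y × M.tensor Y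

variable (c : ColumnData M R) (Y : Bimodule k A D)

instance : AddCommGroup (c.Column Y) := inferInstanceAs (AddCommGroup (Y × M.tensor Y))

instance : SMul R (c.Column Y) :=
  ⟨fun r z => (c.toFst r • z.1, Bimodule.tmul M Y (c.coeff r) z.1 + c.toSnd r • z.2)⟩

variable {Y}

lemma smul_fst (r : R) (z : c.Column Y) : (r • z).1 = c.toFst r • z.1 := rfl

lemma smul_snd (r : R) (z : c.Column Y) :
    (r • z).2 = Bimodule.tmul M Y (c.coeff r) z.1 + c.toSnd r • z.2 := rfl

lemma add_fst (y z : c.Column Y) : (y + z).1 = y.1 + z.1 := rfl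
lemma add_snd (y z : c.Column Y) : (y + z).2 = y.2 + z.2 := rfl
lemma zero_fst : (0 : c.Column Y).1 = 0 := rfl
lemma zero_snd : (0 : c.Column Y).2 = 0 := rfl

open Bimodule in
instance : Module R (c.Column Y) where
  one_smul z := Prod.ext
    (by rw [smul_fst, map_one, one_smul])
    (by rw [smul_snd, coeff_one, zero_tmul, zero_add, map_one, one_smul])
  mul_smul r s z := Prod.ext
    (by rw [smul_fst, smul_fst, smul_fst, map_mul, mul_smul])
    (by rw [smul_snd, smul_snd, smul_snd, smul_fst, coeff_mul, Bimodule.add_tmul, op_smul_tmul,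
          map_mul, mul_smul, smul_add, smul_tmul, add_assoc])
  smul_zero r := Prod.ext
    (by rw [smul_fst, zero_fst, smul_zero])
    (by rw [smul_snd, zero_fst, zero_snd, Bimodule.tmul_zero, smul_zero, add_zero])
  smul_add r y z := Prod.ext
    (by rw [smul_fst, add_fst, smul_add, add_fst, smul_fst, smul_fst])
    (by rw [smul_snd, add_fst, add_snd, Bimodule.tmul_add, smul_add, add_snd, smul_snd, smul_snd,
          add_add_add_comm])
  add_smul r s z := Prod.ext
    (by rw [smul_fst, map_add, add_smul, add_fst, smul_fst, smul_fst])
    (by rw [smul_snd, map_add, map_add, Bimodule.add_tmul, add_smul, add_snd, smul_snd, smul_snd,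
          add_add_add_comm])
  zero_smul z := Prod.ext
    (by rw [smul_fst, map_zero, zero_smul, zero_fst])
    (by rw [smul_snd, map_zero, map_zero, Bimodule.zero_tmul, zero_smul, add_zero, zero_snd])

/-- The inclusion of `Y` into the column module. -/
def inl (Y : Bimodule k A D) : Y →+ c.Column Y := AddMonoidHom.inl Y (M.tensor Y)

/-- The inclusion of `M ⊗_A Y` into the column module. -/
def inr (Y : Bimodule k A D) : M.tensor Y →+ c.Column Y := AddMonoidHom.inr Y (M.tensor Y)

@[simp] lemma inl_fst (y : Y) : (c.inl Y y).1 = y := rfl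
@[simp] lemma inl_snd (y : Y) : (c.inl Y y).2 = 0 := rfl
@[simp] lemma inr_fst (t : M.tensor Y) : (c.inr Y t).1 = 0 := rfl
@[simp] lemma inr_snd (t : M.tensor Y) : (c.inr Y t).2 = t := rfl

lemma inl_add_inr (z : c.Column Y) : c.inl Y z.1 + c.inr Y z.2 = z :=
  Prod.ext (add_zero z.1) (zero_add z.2)

lemma smul_inr (r : R) (t : M.tensor Y) : r • c.inr Y t = c.inr Y (c.toSnd r • t) :=
  Prod.ext
    (by rw [smul_fst, inr_fst, inr_fst, smul_zero])
    (by rw [smul_snd, inr_fst, inr_snd, inr_snd, Bimodule.tmul_zero, zero_add])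

/-- The inclusion of `M ⊗_A Y` as a submodule of the column module. -/
noncomputable def inclusion (Y : Bimodule k A D) :
    inflate c.toSnd (M.tensor Y) →ₗ[R] c.Column Y where
  toFun := c.inr Y
  map_add' := (c.inr Y).map_add
  map_smul' r t := (c.smul_inr r t).symm

/-- The projection of the column module onto `Y`. -/
noncomputable def projection (Y : Bimodule k A D) :
    c.Column Y →ₗ[R] inflate c.toFst Y where
  toFun z := z.1
  map_add' _ _ := rfl
  map_smul' _ _ := rfl

/-- The linear map out of the column module of `Y` induced by an additive map `h` with
`h (a y) = diag a • h y`. -/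
def desc {Z : Type*} [AddCommGroup Z] [Module R Z] (h : Y →+ Z)
    (hh : ∀ a y, h (a • y) = c.diag a • h y) : c.Column Y →ₗ[R] Z :=
  have hbal : ∀ (m : M) (a : A) (y : Y), c.offDiag (op a • m) • h y = c.offDiag m • h (a • y) :=
    fun m a y => by
      rw [hh, smul_smul, c.mul_diag, c.toFst_offDiag, c.coeff_offDiag, zero_mul, map_zero,
        zero_add]
  let f : M →+ Y →+ Z := AddMonoidHom.mk' (fun m => AddMonoidHom.mk' (fun y => c.offDiag m • h y)
    fun y y' => by rw [map_add, smul_add])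
    fun m m' => AddMonoidHom.ext fun y => by
      change c.offDiag (m + m') • h y = c.offDiag m • h y + c.offDiag m' • h y
      rw [map_add, add_smul]
  let F : M.tensor Y →+ Z := Bimodule.liftAddHom f hbal
  have hF : ∀ (r : R) (t : M.tensor Y), F (c.toSnd r • t) = r • F t := fun r t => by
    induction t using Bimodule.tensor_induction with
    | zero => rw [smul_zero, map_zero, smul_zero]
    | tmul m y =>
      change c.offDiag (c.toSnd r • m) • h y = r • c.offDiag m • h y
      rw [smul_smul, c.mul_offDiag]
    | add s t hs ht => rw [smul_add, map_add, hs, ht, map_add, smul_add]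
  -- `diag 1` is only an idempotent of `R`, but it fixes the image of `h`, so `r` may be replaced by
  -- `r * diag 1`.
  have hd : ∀ (r : R) (y : Y), r • h y = h (c.toFst r • y) + c.offDiag (c.coeff r) • h y :=
    fun r y => by
      conv_lhs => rw [← one_smul A y, hh, smul_smul, c.mul_diag, mul_one, op_one, one_smul,
        add_smul, ← hh]
  { toFun := fun z => h z.1 + F z.2
    map_add' := fun y z => by
      rw [add_fst, add_snd, map_add, map_add, add_add_add_comm]
    map_smul' := fun r z => by
      rw [smul_fst, smul_snd, map_add, hF, RingHom.id_apply, smul_add, hd, add_assoc]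
      rfl }

lemma desc_inl {Z : Type*} [AddCommGroup Z] [Module R Z] (h : Y →+ Z)
    (hh : ∀ a y, h (a • y) = c.diag a • h y) (y : Y) : c.desc h hh (c.inl Y y) = h y :=
  (congrArg (h y + ·) (map_zero _)).trans (add_zero _)

lemma offDiag_smul_inl (m : M) (y : Y) :
    c.offDiag m • c.inl Y y = c.inr Y (Bimodule.tmul M Y m y) :=
  Prod.ext
    (by rw [smul_fst, c.toFst_offDiag, zero_smul, inr_fst])
    (by rw [smul_snd, c.coeff_offDiag, inl_fst, inl_snd, smul_zero, add_zero, inr_snd])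

/-- The copy of `Y` generates the column, since `offDiag m` carries `y` to `m ⊗ y`. -/
lemma hom_ext {Z : Type*} [AddCommGroup Z] [Module R Z] {f g : c.Column Y →ₗ[R] Z}
    (h : ∀ y : Y, f (c.inl Y y) = g (c.inl Y y)) : f = g := by
  have hinr : f.toAddMonoidHom.comp (c.inr Y) = g.toAddMonoidHom.comp (c.inr Y) :=
    Bimodule.addHom_ext fun m y => by
      have := congrArg (c.offDiag m • ·) (h y)
      simp only [← map_smul, offDiag_smul_inl] at this
      exact this
  refine LinearMap.ext fun z => ?_
  rw [← c.inl_add_inr z, map_add, map_add, h]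
  exact congrArg _ (DFunLike.congr_fun hinr z.2)

lemma diag_mul (a a' : A) : c.diag (a * a') = c.diag a * c.diag a' := by
  rw [c.mul_diag, c.toFst_diag, c.coeff_diag, smul_zero, map_zero, add_zero]

lemma diag_smul_inl (a : A) (y : Y) : c.diag a • c.inl Y y = c.inl Y (a • y) :=
  Prod.ext
    (by rw [smul_fst, c.toFst_diag, inl_fst, inl_fst])
    (by rw [smul_snd, c.coeff_diag, inl_snd, inl_snd, smul_zero, add_zero, Bimodule.zero_tmul])

/-- The column module of a projective module is projective. -/
lemma projective_column [Module.Projective A Y] : Module.Projective R (c.Column Y) := by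
  obtain ⟨s, hs⟩ := Module.projective_def'.1 (inferInstance : Module.Projective A Y)
  -- A splitting of `A^(Y) → Y`, pushed along `diag`, induces a splitting of `R^(Y) → Column Y`.
  let h : Y →+ (Y →₀ R) := (Finsupp.mapRange.addMonoidHom c.diag).comp s.toAddMonoidHom
  have hh : ∀ a y, h (a • y) = c.diag a • h y := fun a y => by
    ext z
    simp [h, diag_mul]
  let p : (Y →₀ R) →ₗ[R] c.Column Y := Finsupp.linearCombination R (c.inl Y)
  have key : ∀ t : Y →₀ A, p (Finsupp.mapRange.addMonoidHom c.diag t) =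
      c.inl Y (Finsupp.linearCombination A id t) := by
    intro t
    induction t using Finsupp.induction_linear with
    | zero => rw [map_zero, map_zero, map_zero, map_zero]
    | add f g hf hg => rw [map_add, map_add, hf, hg, map_add, map_add]
    | single y a =>
      rw [Finsupp.mapRange.addMonoidHom_apply, Finsupp.mapRange_single,
        Finsupp.linearCombination_single, Finsupp.linearCombination_single, diag_smul_inl, id]
  refine Module.Projective.of_split (c.desc h hh) p (c.hom_ext fun y => ?_)
  rw [LinearMap.comp_apply, desc_inl]
  refine (key (s y)).trans ?_
  rw [← LinearMap.comp_apply, hs]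
  rfl

/-- In `0 → M ⊗_A Y → Column Y → Y → 0` the middle term is projective, so passing from `M ⊗_A Y` to
`Y` costs one dimension. -/
lemma hasProjectiveDimensionLT_inflate [Module.Projective A Y] {n : ℕ}
    (h : HasProjectiveDimensionLT (inflate c.toSnd (M.tensor Y)) n) :
    HasProjectiveDimensionLT (inflate c.toFst Y) (n + 1) := by
  have hP : Projective (ModuleCat.of R (c.Column Y)) :=
    (IsProjective.iff_projective (R := R) (c.Column Y)).1 c.projective_column
  refine (ModuleCat.shortExact_of_linearMap (Y := ModuleCat.of R (c.Column Y))
    (c.inclusion Y) (c.projection Y) ?_ ?_ ?_).hasProjectiveDimensionLT_X₃ n h inferInstance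
  · exact fun s t hst => congrArg Prod.snd hst
  · intro z
    constructor
    · intro hz
      exact ⟨z.2, Prod.ext hz.symm rfl⟩
    · rintro ⟨t, rfl⟩
      rfl
  · exact fun y => ⟨c.inl Y y, rfl⟩

end ColumnData

/-! ### Alternating the two columns until the syzygy vanishes. -/

variable {k : Type v} [Field k] {A B : Type u} [Ring A] [Ring B] [Algebra k A] [Algebra k B]

/-- A left module as a bimodule over the centre. -/
noncomputable def Bimodule.ofModule (k : Type v) [Field k] {A : Type u} [Ring A] [Algebra k A]
    (Y : Type u) [AddCommGroup Y] [Module A Y] : Bimodule k A (Subalgebra.center k A) :=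
  -- Some right action is needed to regard `Y` as a bimodule. The centre lies in the universe of
  -- `A`, unlike `k`, and acts compatibly on every module.
  let φ : (Subalgebra.center k A)ᵐᵒᵖ →+* A := (Subalgebra.center k A).subtype.comp
    (RingEquiv.toOpposite (Subalgebra.center k A)).symm.toRingHom
  letI mk : Module k Y := Module.compHom Y (algebraMap k A)
  letI mD : Module (Subalgebra.center k A)ᵐᵒᵖ Y := Module.compHom Y φ
  { carrier := Y
    smulCommClass := ⟨fun a d y => by
      change a • (d.unop : A) • y = (d.unop : A) • a • y
      rw [smul_smul, smul_smul, Subalgebra.mem_center_iff.1 d.unop.2 a]⟩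
    leftTower := ⟨fun r a y => by
      change (r • a) • y = algebraMap k A r • a • y
      rw [smul_smul, Algebra.smul_def]⟩
    rightTower := ⟨fun r d y => by
      change (r • d.unop : A) • y = algebraMap k A r • (d.unop : A) • y
      rw [smul_smul, Algebra.smul_def]⟩ }

namespace ColumnData

variable {M : Bimodule k B A} {N : Bimodule k A B} {R : Type u} [Ring R]

/-- Here `Y` plays the role of the syzygy after `m` double steps, with `j = n - m` left. Each double
step uses both columns, whence `2 * j`; at `j = 0` the syzygy is generated by a zero module. -/
lemma hasProjectiveDimensionLT_inflate_of_tensorPow (c : ColumnData M R) (c' : ColumnData N R)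
    (h₁ : c'.toFst = c.toSnd) (h₂ : c'.toSnd = c.toFst) (hM : Module.Projective B M)
    (hN : Module.Projective A N) {n : ℕ} (hn : Subsingleton ((N.tensor M).tensorPow n))
    {D : Type u} [Ring D] [Algebra k D] (j m : ℕ) (hmj : m + j = n) (Y : Bimodule k A D)
    (hY : Module.Projective A Y) (hgen : ((N.tensor M).tensorPow m).Generates Y) :
    HasProjectiveDimensionLT (inflate c.toFst Y) (2 * j) := by
  induction j generalizing m Y with
  | zero =>
    obtain rfl : m = n := hmj
    have := hgen.subsingleton
    exact (ModuleCat.isZero_of_iff_subsingleton (M := inflate c.toFst Y) |>.2 this).hasProjectiveDimensionLT_zero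
  | succ j ih =>
    have hMY : Module.Projective B (M.tensor Y) := Bimodule.projective_tensor M Y
    have := ih (m + 1) (by omega) (N.tensor (M.tensor Y)) (Bimodule.projective_tensor _ _)
      (hgen.tensor_tensor N M)
    rw [← h₂] at this
    have := c'.hasProjectiveDimensionLT_inflate this
    rw [h₁] at this
    exact c.hasProjectiveDimensionLT_inflate this

/-- Inflations of projective modules have bounded projective dimension. -/
lemma hasProjectiveDimensionLT_inflate_projective (c : ColumnData M R) (c' : ColumnData N R)
    (h₁ : c'.toFst = c.toSnd) (h₂ : c'.toSnd = c.toFst) (hM : Module.Projective B M)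
    (hN : Module.Projective A N) {n : ℕ} (hn : Subsingleton ((N.tensor M).tensorPow n))
    {D : Type u} [Ring D] [Algebra k D] (Y : Bimodule k A D) (hY : Module.Projective A Y) :
    HasProjectiveDimensionLT (inflate c.toFst Y) (2 * n) :=
  c.hasProjectiveDimensionLT_inflate_of_tensorPow c' h₁ h₂ hM hN hn n 0 (zero_add n) Y hY
    (Bimodule.generates_regular Y)

end ColumnData

/-! ### The two columns of the null-square algebra, and the conclusion. -/

namespace NullSquareAlgebra

variable (M : Bimodule k B A) (N : Bimodule k A B)

/-- The projection of the null-square algebra onto its upper left entry. -/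
def toUpper : NullSquareAlgebra M N →+* A where
  toFun := a
  map_one' := rfl
  map_mul' _ _ := rfl
  map_zero' := rfl
  map_add' _ _ := rfl

/-- The projection of the null-square algebra onto its lower right entry. -/
def toLower : NullSquareAlgebra M N →+* B where
  toFun := b
  map_one' := rfl
  map_mul' _ _ := rfl
  map_zero' := rfl
  map_add' _ _ := rfl

/-- The first column of the null-square algebra. -/
def firstColumn : ColumnData M (NullSquareAlgebra M N) where
  toFst := toUpper M N
  toSnd := toLower M N
  coeff := AddMonoidHom.mk' m fun _ _ => rfl
  coeff_mul _ _ := rfl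
  diag := AddMonoidHom.mk' (fun a => ⟨a, 0, 0, 0⟩) fun _ _ => by ext <;> simp
  offDiag := AddMonoidHom.mk' (fun m => ⟨0, 0, m, 0⟩) fun _ _ => by ext <;> simp
  toFst_diag _ := rfl
  coeff_diag _ := rfl
  toFst_offDiag _ := rfl
  coeff_offDiag _ := rfl
  mul_diag _ _ := by ext <;> simp [toUpper]
  mul_offDiag _ _ := by ext <;> simp [toLower]

/-- The second column of the null-square algebra. -/
def secondColumn : ColumnData N (NullSquareAlgebra M N) where
  toFst := toLower M N
  toSnd := toUpper M N
  coeff := AddMonoidHom.mk' n fun _ _ => rfl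
  coeff_mul _ _ := add_comm _ _
  diag := AddMonoidHom.mk' (fun b => ⟨0, 0, 0, b⟩) fun _ _ => by ext <;> simp
  offDiag := AddMonoidHom.mk' (fun n => ⟨0, n, 0, 0⟩) fun _ _ => by ext <;> simp
  toFst_diag _ := rfl
  coeff_diag _ := rfl
  toFst_offDiag _ := rfl
  coeff_offDiag _ := rfl
  mul_diag _ _ := by ext <;> simp [toLower]
  mul_offDiag _ _ := by ext <;> simp [toUpper]

lemma toUpper_surjective : Function.Surjective (toUpper M N) := fun a => ⟨⟨a, 0, 0, 0⟩, rfl⟩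

lemma toLower_surjective : Function.Surjective (toLower M N) := fun b => ⟨⟨0, 0, 0, b⟩, rfl⟩

/-- The first two conditions leave only an `M`-entry in `r * s`, and it meets only `t.a` on the
right. -/
lemma mul_mul_eq_zero {r s t : NullSquareAlgebra M N} (hr : r.a = 0) (hs : s.b = 0)
    (ht : t.a = 0) : r * s * t = 0 := by
  ext <;> simp [hr, hs, ht]

end NullSquareAlgebra

open NullSquareAlgebra in
theorem mainTheorem3 {k : Type v} [Field k] [PerfectField k]
    {A B : Type u} [Ring A] [Ring B] [Algebra k A] [Algebra k B]
    (M : Bimodule k B A) (N : Bimodule k A B)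
    (hΛ : FiniteDimensional k (NullSquareAlgebra M N))
    (hM : M.IsProjective) (hN : N.IsProjective)
    (hA : IsSmoothAlgebra k A) (hB : IsSmoothAlgebra k B)
    (hNM : ∃ n₀ : ℕ, ∀ n ≥ n₀, Subsingleton ((N.tensor M).tensorPow n)) :
    IsSmoothAlgebra k (NullSquareAlgebra M N) := by
  obtain ⟨n, hn⟩ := hNM
  obtain ⟨d, hd⟩ := (globalDimension_lt_top_iff A).1 hA.2
  obtain ⟨e, he⟩ := (globalDimension_lt_top_iff B).1 hB.2
  have hM' := hM.projective_left
  have hN' := hN.projective_left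
  have hU : ∀ {D : Type u} [Ring D] [Algebra k D] (Y : Bimodule k A D),
      Module.Projective A Y → HasProjectiveDimensionLT (inflate (toUpper M N) Y) (2 * n) :=
    fun Y hY => (firstColumn M N).hasProjectiveDimensionLT_inflate_projective (secondColumn M N)
      rfl rfl hM' hN' (hn n le_rfl) Y hY
  -- One step along the second column reduces `B` to `A`, so the powers of `M ⊗_A N` are not needed.
  have hL : ∀ {D : Type u} [Ring D] [Algebra k D] (Y : Bimodule k B D),
      Module.Projective B Y → HasProjectiveDimensionLT (inflate (toLower M N) Y) (2 * n + 1) :=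
    fun Y _ => (secondColumn M N).hasProjectiveDimensionLT_inflate
      (hU (N.tensor Y) (Bimodule.projective_tensor N Y))
  refine ⟨hΛ, (globalDimension_lt_top_iff _).2 ⟨2 * n + 1 + d + e, fun X => ?_⟩⟩
  -- A common bound for `2 * n + d` from `A` and `2 * n + 1 + e` from `B`; the final `+ 1` turns `≤`
  -- into `<`.
  refine hasProjectiveDimensionLT_of_ideals (n := 2 * n + 1 + d + e + 1) (RingHom.ker (toUpper M N))
    (RingHom.ker (toLower M N)) (fun r hr s hs t ht => mul_mul_eq_zero M N hr hs ht)
    (hasProjectiveDimensionLT_of_ker_smul_eq_zero _ (toUpper_surjective M N) fun Y => ?_)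
    (hasProjectiveDimensionLT_of_ker_smul_eq_zero _ (toLower_surjective M N) fun Y => ?_) X
  · have := hasProjectiveDimensionLT_restrictScalars (toUpper M N) (fun P hP =>
      hU (Bimodule.ofModule k P) ((IsProjective.iff_projective (R := A) P).2 hP)) d Y (hd Y)
    exact hasProjectiveDimensionLT_of_ge _ (2 * n + d) _ (by omega)
  · have := hasProjectiveDimensionLT_restrictScalars (toLower M N) (fun P hP =>
      hL (Bimodule.ofModule k P) ((IsProjective.iff_projective (R := B) P).2 hP)) e Y (he Y)
    exact hasProjectiveDimensionLT_of_ge _ (2 * n + 1 + e) _ (by omega)
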